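/- **Definitions.** A *directed graph* $\mathcal G=(E_{\mathcal G},V_{\mathcal G},s,t)$ consists of sets $E_{\mathcal G}$ of edges and $V_{\mathcal G}$ of nodes and functions $s,t:E_{\mathcal G}\to V_{\mathcal G}$; a morphism is a pair $(h_1,h_2)$ of functions on edges and on nodes commuting with $s$ and $t$. $\mathbf{Graph}$ is the resulting category. $\mathbf{SGraph}$ is its full subcategory of graphs in which two edges with the same source and the same target are equal, and $\mathbf{DAG}$ is the full subcategory of those graphs in $\mathbf{SGraph}$ without cycles (a cycle is a non-empty finite list of edges $e_1,\dots,e_n$ with $t(e_i)=s(e_{i+1})$ for $1\le i<n$ and $s(e_1)=t(e_n)$; in particular loops are cycles). A morphism $(h_1,h_2):\mathcal G\to\mathcal H$ of directed graphs is *downward closed* if it is a monomorphism of $\mathbf{Graph}$ and every $e\in E_{\mathcal H}$ with $t(e)\in h_2(V_{\mathcal G})$ belongs to $h_1(E_{\mathcal G})$. An *$\mathbf{SGraph}$-hypergraph* is a triple $(\mathcal G,V,e)$ where $\mathcal G$ is in $\mathbf{SGraph}$ (the nodes of $\mathcal G$ are the hyperedges), $V$ is a set (the nodes of the hypergraph)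 and $e:V_{\mathcal G}\to V^{\star}$ is a function to the set of finite words on $V$. A morphism $(\mathcal G,V,e)\to(\mathcal H,W,e')$ is a pair $((h_1,h_2),k)$ with $(h_1,h_2):\mathcal G\to\mathcal H$ in $\mathbf{SGraph}$ and $k:V\to W$ a function such that $e'\circ h_2=k^{\star}\circ e$. This defines the category $\mathbf{SHGraph}$; replacing $\mathbf{SGraph}$ by $\mathbf{DAG}$ defines the category $\mathbf{DAGHGraph}$ of *$\mathbf{DAG}$-hypergraphs*. Let $\mathcal M,\mathcal N$ be classes of morphisms of a category $\mathbf A$. Say that $\mathcal A$ is *closed under $\mathcal B$-decomposition* if $g\circ f\in\mathcal A$ and $g\in\mathcal B$ imply $f\in\mathcal A$. A commutative square is a *Van Kampen square* if, for every commutative cube having it as bottom face and whose back faces are pullbacks, the top face is a pushout if and only if the front faces are pullbacks. $\mathbf A$ is *$\mathcal M,\mathcal N$-adhesive* if every morphism in $\mathcal M$ is a monomorphism and 1. $\mathcal M$ and $\mathcal N$ contain all isomorphisms and are closed under composition; $\mathcal M$ is closed under $\mathcal M$-decomposition and $\mathcal N$ under $\mathcal N$-decomposition; 2. $\mathcal N$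 is closed under $\mathcal M$-decomposition; 3. $\mathcal M$ and $\mathcal N$ are stable under all pullbacks and all pushouts that exist in $\mathbf A$; 4. every cospan $C\xrightarrow{g}D\xleftarrow{m}B$ with $m\in\mathcal M$ has a pullback; 5. every span $C\xleftarrow{m}A\xrightarrow{n}B$ with $m\in\mathcal M$ and $n\in\mathcal N$ has a pushout; 6. every pushout square of a span as in 5 is a Van Kampen square. **Theorem.** $\mathbf{SHGraph}$ is $\mathcal M,\mathcal N$-adhesive for $$\mathcal M=\{((h_1,h_2),k)\mid (h_1,h_2)\text{ is a regular monomorphism of }\mathbf{SGraph},\ k\text{ is injective}\},$$ $$\mathcal N=\{((h_1,h_2),k)\mid (h_1,h_2)\text{ is a monomorphism of }\mathbf{SGraph}\},$$ and $\mathbf{DAGHGraph}$ is $\mathcal M,\mathcal N$-adhesive for $$\mathcal M=\{((h_1,h_2),k)\mid (h_1,h_2)\text{ is downward closed},\ k\text{ is injective}\},$$ $$\mathcal N=\{((h_1,h_2),k)\mid (h_1,h_2)\text{ is a monomorphism of }\mathbf{DAG}\}.$$ Moreover, the functors $\mathbf{SHGraph}\to\mathbf{Set}$ and $\mathbf{DAGHGraph}\to\mathbf{Set}$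 which send $(\mathcal G,V,e)$ to its set of nodes $V$ and $((h_1,h_2),k)$ to $k$ have left adjoints. -/

import Mathlib

open CategoryTheory CategoryTheory.Limits

universe u v w

/-! ## Categories that are adhesive with respect to two classes of morphisms -/

/-- The category `C` is `M, N`-adhesive. A class is closed under `B`-decomposition if
`f ≫ g ∈ A` and `g ∈ B` imply `f ∈ A`; this is `HasOfPostcompProperty A B`. Stability under
pullbacks (pushouts) refers to all pullback (pushout) squares of `C`. -/
structure IsMNAdhesive {C : Type u} [Category.{v} C] (M N : MorphismProperty C) : Prop where
  mono : M ≤ MorphismProperty.monomorphisms C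
  isoM : MorphismProperty.isomorphisms C ≤ M
  isoN : MorphismProperty.isomorphisms C ≤ N
  compM : M.IsStableUnderComposition
  compN : N.IsStableUnderComposition
  decompM : M.HasOfPostcompProperty M
  decompN : N.HasOfPostcompProperty N
  decompNM : N.HasOfPostcompProperty M
  pullbackM : M.IsStableUnderBaseChange
  pullbackN : N.IsStableUnderBaseChange
  pushoutM : M.IsStableUnderCobaseChange
  pushoutN : N.IsStableUnderCobaseChange
  hasPullback : ∀ {X Y Z : C} (g : X ⟶ Z) (m : Y ⟶ Z), M m → HasPullback g m
  hasPushout : ∀ {X Y Z : C} (m : X ⟶ Y) (n : X ⟶ Z), M m → N n → HasPushout m n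
  vanKampen : ∀ {W X Y Z : C} {m : W ⟶ X} {n : W ⟶ Y} {h : X ⟶ Z} {i : Y ⟶ Z}
    (sq : IsPushout m n h i), M m → N n → sq.IsVanKampen

/-! ## Directed graphs -/

/-- A directed graph: edges, nodes, source and target. -/
structure DirGraph : Type (w + 1) where
  E : Type w
  V : Type w
  s : E → V
  t : E → V

namespace DirGraph

/-- A morphism of directed graphs: a function on edges and one on nodes which commute with
source and target. -/
@[ext]
structure Hom (G H : DirGraph.{w}) : Type w where
  onE : G.E → H.E
  onV : G.V → H.V
  map_s : ∀ e, H.s (onE e) = onV (G.s e)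
  map_t : ∀ e, H.t (onE e) = onV (G.t e)

instance : Category.{w} DirGraph.{w} where
  Hom := Hom
  id G := { onE := fun e => e, onV := fun x => x, map_s := fun _ => rfl, map_t := fun _ => rfl }
  comp f g :=
    { onE := fun e => g.onE (f.onE e)
      onV := fun x => g.onV (f.onV x)
      map_s := fun e => by rw [g.map_s, f.map_s]
      map_t := fun e => by rw [g.map_t, f.map_t] }

/-- There is at most one edge from a node to another. -/
def IsSimple (G : DirGraph.{w}) : Prop :=
  ∀ e e' : G.E, G.s e = G.s e' → G.t e = G.t e' → e = e'

/-- A path: a non-empty finite list of edges, each ending where the next one starts. -/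
def IsPath (G : DirGraph.{w}) (l : List G.E) : Prop :=
  l ≠ [] ∧ l.IsChain (fun e e' => G.t e = G.s e')

/-- A cycle: a path whose first edge starts where its last edge ends. -/
def IsCycle (G : DirGraph.{w}) (l : List G.E) : Prop :=
  G.IsPath l ∧ ∃ h : l ≠ [], G.s (l.head h) = G.t (l.getLast h)

/-- A directed acyclic graph: a directed simple graph without cycles. -/
def IsDAG (G : DirGraph.{w}) : Prop :=
  G.IsSimple ∧ ∀ l : List G.E, ¬ G.IsCycle l

/-- Downward closed morphisms: monomorphisms such that every edge of the codomain whose target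
is in the image on nodes is itself in the image on edges. -/
def IsDownwardClosed {G H : DirGraph.{w}} (f : G ⟶ H) : Prop :=
  Mono f ∧ ∀ e : H.E, H.t e ∈ Set.range f.onV → e ∈ Set.range f.onE

/-- The functor sending a directed graph to its set of nodes. -/
def nodes : DirGraph.{w} ⥤ Type w where
  obj G := G.V
  map f := TypeCat.ofHom f.onV

end DirGraph

/-- The category of directed simple graphs, a full subcategory of directed graphs. -/
abbrev SGraph : Type (w + 1) :=
  ObjectProperty.FullSubcategory (fun G : DirGraph.{w} => G.IsSimple)

/-- The category of directed acyclic graphs, a full subcategory of directed graphs. -/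
abbrev DAG : Type (w + 1) :=
  ObjectProperty.FullSubcategory (fun G : DirGraph.{w} => G.IsDAG)

/-- The functor sending a directed simple graph to its set of nodes. -/
abbrev SGraph.nodes : SGraph.{w} ⥤ Type w :=
  ObjectProperty.ι _ ⋙ DirGraph.nodes

/-- The functor sending a directed acyclic graph to its set of nodes. -/
abbrev DAG.nodes : DAG.{w} ⥤ Type w :=
  ObjectProperty.ι _ ⋙ DirGraph.nodes

/-- The Kleene star: a set is sent to the set of finite words on it. -/
def kleeneStar : Type w ⥤ Type w where
  obj X := List X
  map f := TypeCat.ofHom (List.map f)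
  map_id X := by ext l; simp
  map_comp f g := by ext l; simp

/-! ## Hypergraphs whose hyperedges are the nodes of a graph -/

/-- The category of `SGraph`-hypergraphs. An object is a directed simple graph `left`, whose nodes
are the hyperedges, a set `right` of nodes and a function `hom` sending every hyperedge to a
word of nodes. A morphism is a morphism of graphs and a function on nodes making the evident
square commute. -/
abbrev SHGraph : Type (w + 1) := Comma SGraph.nodes.{w} kleeneStar.{w}

/-- The category of `DAG`-hypergraphs; as `SHGraph`, with a directed acyclic graph whose nodes are
the hyperedges. -/
abbrev DAGHGraph : Type (w + 1) := Comma DAG.nodes.{w} kleeneStar.{w}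

/-- The functor sending an `SGraph`-hypergraph to its set of nodes. -/
abbrev SHGraph.nodeSet : SHGraph.{w} ⥤ Type w := Comma.snd _ _

/-- The functor sending a `DAG`-hypergraph to its set of nodes. -/
abbrev DAGHGraph.nodeSet : DAGHGraph.{w} ⥤ Type w := Comma.snd _ _

/-- Morphisms `(h, k)` with `h` a regular monomorphism of `SGraph` and `k` a monomorphism of
sets. -/
def SHGraph.classM : MorphismProperty SHGraph.{w} :=
  fun _ _ f => IsRegularMono f.left ∧ Mono f.right

/-- Morphisms `(h, k)` with `h` a monomorphism of `SGraph` and `k` arbitrary. -/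
def SHGraph.classN : MorphismProperty SHGraph.{w} :=
  fun _ _ f => Mono f.left

/-- Morphisms `(h, k)` with `h` downward closed and `k` a monomorphism of sets. -/
def DAGHGraph.classM : MorphismProperty DAGHGraph.{w} :=
  fun _ _ f => DirGraph.IsDownwardClosed f.left.hom ∧ Mono f.right

/-- Morphisms `(h, k)` with `h` a monomorphism of `DAG` and `k` arbitrary. -/
def DAGHGraph.classN : MorphismProperty DAGHGraph.{w} :=
  fun _ _ f => Mono f.left

/-! ## Directed graphs: elementary facts -/

namespace DirGraph

variable {G H K : DirGraph.{w}}

/-! Both categories are instances of `HGraph P`, for a class `P` of simple graphs containing every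
simple graph that maps to a member. There `M` becomes `closedEmb P a`: for `a` false its graph part
reflects edges, which characterises regular monomorphisms of `SGraph`; for `a` true it is downward
closed. `N` becomes injectivity on hyperedges.

The axioms are reduced to the adhesivity of sets, applied to edges, hyperedges and nodes. Pullbacks
are always componentwise, because the Kleene star preserves them (`isPullback_iff`). A pushout is
componentwise on hyperedges and nodes, but on edges it is only jointly surjective, since parallel
edges get merged (`isNodePushout`). For a span `X ← A → Y` in `M` and `N` this merging adds nothing:
edges of `X` and `Y` with the same image have endpoints coming from `A`, so closedness gives a
common edge of `A`. Such pushouts are therefore componentwise on edges too (`isSetPushout`), and the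
Van Kampen property follows from three cubes of sets.

For DAGs the pushout must moreover be acyclic (`IsNodePushout.isDAG`): the image of `Y` is downward
closed in it, so a cycle meeting this image lies in `Y`, and a cycle avoiding it lifts to `X`.

The left adjoints send a set to the hypergraph on it without hyperedges. -/

@[simp]
lemma comp_onE (f : G ⟶ H) (g : H ⟶ K) (e : G.E) : (f ≫ g).onE e = g.onE (f.onE e) := rfl

@[simp]
lemma comp_onV (f : G ⟶ H) (g : H ⟶ K) (x : G.V) : (f ≫ g).onV x = g.onV (f.onV x) := rfl

@[simp]
lemma id_onE (e : G.E) : Hom.onE (𝟙 G) e = e := rfl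

/-- The functor sending a directed graph to its set of edges. -/
def edges : DirGraph.{w} ⥤ Type w where
  obj G := G.E
  map f := TypeCat.ofHom f.onE

lemma hom_ext {f g : G ⟶ H} (hE : ∀ e, f.onE e = g.onE e) (hV : ∀ x, f.onV x = g.onV x) :
    f = g :=
  Hom.ext (funext hE) (funext hV)

lemma hom_ext_of_isSimple (hH : H.IsSimple) {f g : G ⟶ H} (hV : ∀ x, f.onV x = g.onV x) :
    f = g :=
  hom_ext (fun e => hH _ _ (by rw [f.map_s, g.map_s, hV]) (by rw [f.map_t, g.map_t, hV])) hV

lemma onE_injective (hG : G.IsSimple) (f : G ⟶ H) (h : Function.Injective f.onV) :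
    Function.Injective f.onE := fun e e' he =>
  hG _ _ (h (by rw [← f.map_s, ← f.map_s, he])) (h (by rw [← f.map_t, ← f.map_t, he]))

/-- The graph with one node and no edges. -/
def point : DirGraph.{w} where
  E := PEmpty
  V := PUnit
  s := PEmpty.elim
  t := PEmpty.elim

/-- The morphism from the one-node graph selecting a node. -/
def pointHom (x : G.V) : point ⟶ G where
  onE := PEmpty.elim
  onV _ := x
  map_s e := e.elim
  map_t e := e.elim

lemma point_isSimple : point.{w}.IsSimple := fun e => e.elim

lemma mono_of_injective (hG : G.IsSimple) {f : G ⟶ H} (h : Function.Injective f.onV) : Mono f where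
  right_cancellation a b hab := by
    refine hom_ext (fun e => onE_injective hG f h ?_) (fun x => h ?_)
    · exact congrFun (congrArg Hom.onE hab) e
    · exact congrFun (congrArg Hom.onV hab) x

lemma injective_of_mono (f : G ⟶ H) [Mono f] : Function.Injective f.onV := fun x y hxy => by
  have : pointHom x = pointHom y := by
    rw [← cancel_mono f]
    exact hom_ext (fun e => e.elim) fun _ => hxy
  exact congrFun (congrArg Hom.onV this) PUnit.unit

/-! ### Closed embeddings -/

/-- Morphisms which are injective on nodes, and such that every edge of the codomain with target in
the image, and also with source in the image unless `a` holds, is in the image. -/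
def IsClosedEmb (a : Prop) (f : G ⟶ H) : Prop :=
  Function.Injective f.onV ∧ ∀ e : H.E, (a ∨ H.s e ∈ Set.range f.onV) →
    H.t e ∈ Set.range f.onV → e ∈ Set.range f.onE

variable {a : Prop}

lemma IsClosedEmb.of_isIso (f : G ⟶ H) [IsIso f] : IsClosedEmb a f := by
  refine ⟨injective_of_mono f, fun e _ _ => ⟨(inv f).onE e, ?_⟩⟩
  rw [← comp_onE, IsIso.inv_hom_id, id_onE]

lemma IsClosedEmb.comp {f : G ⟶ H} {g : H ⟶ K} (hf : IsClosedEmb a f) (hg : IsClosedEmb a g) :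
    IsClosedEmb a (f ≫ g) := by
  refine ⟨hg.1.comp hf.1, ?_⟩
  rintro e hs ⟨x, hx⟩
  obtain ⟨e, rfl⟩ := hg.2 e (hs.imp_right fun ⟨y, hy⟩ => ⟨_, hy⟩) ⟨_, hx⟩
  rw [g.map_t] at hx
  obtain ⟨e, rfl⟩ := hf.2 e (hs.imp_right fun ⟨y, hy⟩ => ⟨y, hg.1 (by rw [← g.map_s, ← hy]; rfl)⟩)
    ⟨x, hg.1 hx⟩
  exact ⟨e, rfl⟩

lemma IsClosedEmb.of_comp (hH : H.IsSimple) {f : G ⟶ H} {g : H ⟶ K}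
    (hg : Function.Injective g.onV) (h : IsClosedEmb a (f ≫ g)) : IsClosedEmb a f := by
  refine ⟨Function.Injective.of_comp h.1, ?_⟩
  rintro e hs ⟨x, hx⟩
  obtain ⟨e', he⟩ := h.2 (g.onE e)
    (hs.imp_right fun ⟨y, hy⟩ => ⟨y, by rw [g.map_s, ← hy]; rfl⟩)
    ⟨x, by rw [g.map_t, ← hx]; rfl⟩
  exact ⟨e', onE_injective hH g hg he⟩

lemma IsClosedEmb.of_isPullback {A X Y Z : DirGraph.{w}} {t : A ⟶ X} {l : A ⟶ Y} {r : X ⟶ Z}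
    {b : Y ⟶ Z} (hE : IsPullback (edges.map t) (edges.map l) (edges.map r) (edges.map b))
    (hV : IsPullback (nodes.map t) (nodes.map l) (nodes.map r) (nodes.map b))
    (hr : IsClosedEmb a r) : IsClosedEmb a l := by
  have w : ∀ x, r.onV (t.onV x) = b.onV (l.onV x) := ConcreteCategory.congr_hom hV.w
  refine ⟨fun x y hxy => Types.ext_of_isPullback hV (hr.1 ?_) hxy, ?_⟩
  · exact (w x).trans ((congrArg b.onV hxy).trans (w y).symm)
  rintro e hs ⟨x, hx⟩
  obtain ⟨e', he⟩ := hr.2 (b.onE e)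
    (hs.imp_right fun ⟨y, hy⟩ => ⟨t.onV y, by rw [b.map_s, ← hy, w]⟩)
    ⟨t.onV x, by rw [b.map_t, ← hx, w]⟩
  obtain ⟨e₀, -, h⟩ := Types.exists_of_isPullback hE e' e he
  exact ⟨e₀, h⟩

/-! ### Pushouts of simple graphs -/

/-- A commutative square of graphs which is a pushout on nodes and jointly surjective on edges.
When the graphs are simple these are the pushout squares. -/
structure IsNodePushout {A X Y Z : DirGraph.{w}} (t : A ⟶ X) (l : A ⟶ Y) (r : X ⟶ Z)
    (b : Y ⟶ Z) : Prop where
  nodes : IsPushout (nodes.map t) (nodes.map l) (nodes.map r) (nodes.map b)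
  edges : ∀ e : Z.E, (∃ x, r.onE x = e) ∨ ∃ y, b.onE y = e

namespace IsNodePushout

variable {A X Y Z Q : DirGraph.{w}} {t : A ⟶ X} {l : A ⟶ Y} {r : X ⟶ Z} {b : Y ⟶ Z}

lemma comm_onV (h : IsNodePushout t l r b) (x : A.V) : r.onV (t.onV x) = b.onV (l.onV x) :=
  ConcreteCategory.congr_hom h.nodes.w x

lemma flip (h : IsNodePushout t l r b) : IsNodePushout l t b r :=
  ⟨h.nodes.flip, fun e => (h.edges e).symm⟩

/-- Nodes use the universal property in sets. Each edge of `Z` comes from `X` or `Y`, which supplies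
an edge of `Q` between the required endpoints; simplicity of `Q` makes it unique, so the triangles
commute. -/
lemma exists_desc (h : IsNodePushout t l r b) (hQ : Q.IsSimple) (r' : X ⟶ Q) (b' : Y ⟶ Q)
    (w : t ≫ r' = l ≫ b') : ∃ φ : Z ⟶ Q, r ≫ φ = r' ∧ b ≫ φ = b' := by
  let k := h.nodes.desc (DirGraph.nodes.map r') (DirGraph.nodes.map b')
    (by rw [← Functor.map_comp, w, Functor.map_comp])
  have hr : ∀ x, k (r.onV x) = r'.onV x := ConcreteCategory.congr_hom (h.nodes.inl_desc _ _ _)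
  have hb : ∀ x, k (b.onV x) = b'.onV x := ConcreteCategory.congr_hom (h.nodes.inr_desc _ _ _)
  have key : ∀ e : Z.E, ∃ e' : Q.E, Q.s e' = k (Z.s e) ∧ Q.t e' = k (Z.t e) := by
    intro e
    obtain ⟨x, rfl⟩ | ⟨x, rfl⟩ := h.edges e
    · exact ⟨r'.onE x, by rw [r'.map_s, r.map_s, hr], by rw [r'.map_t, r.map_t, hr]⟩
    · exact ⟨b'.onE x, by rw [b'.map_s, b.map_s, hb], by rw [b'.map_t, b.map_t, hb]⟩
  choose φ hs ht using key
  exact ⟨⟨φ, k, hs, ht⟩, hom_ext_of_isSimple hQ hr, hom_ext_of_isSimple hQ hb⟩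

lemma injective (h : IsNodePushout t l r b) (ht : Function.Injective t.onV) :
    Function.Injective b.onV := by
  have : Mono (DirGraph.nodes.map t) := (mono_iff_injective _).2 ht
  exact (mono_iff_injective _).1 (Adhesive.mono_of_isPushout_of_mono_left h.nodes)

lemma exists_of_eq (h : IsNodePushout t l r b) (ht : Function.Injective t.onV) {x : X.V} {y : Y.V}
    (hxy : r.onV x = b.onV y) : ∃ z, t.onV z = x ∧ l.onV z = y :=
  Types.exists_of_isPullback (Types.isPullback_of_isPushout h.nodes ht) x y hxy

/-- Outside the image of `b` nothing is glued: the indicator of `x` on `X` and the constant `False`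
on `Y` agree on `A`, so they descend to a predicate on `Z` separating `x` from the other nodes of
`X`. -/
lemma eq_of_eq (h : IsNodePushout t l r b) {x x' : X.V} (hxx : r.onV x = r.onV x')
    (hx : r.onV x ∉ Set.range b.onV) : x = x' := by
  let p : X.V ⟶ ULift.{w} Prop := TypeCat.ofHom fun u => ⟨u = x⟩
  let q : Y.V ⟶ ULift.{w} Prop := TypeCat.ofHom fun _ => ⟨False⟩
  have w : DirGraph.nodes.map t ≫ p = DirGraph.nodes.map l ≫ q := by
    ext z
    refine iff_of_false (fun hz => hx ⟨l.onV z, ?_⟩) id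
    exact (h.comm_onV z).symm.trans (congrArg r.onV hz)
  let k := h.nodes.desc p q w
  have hk : ∀ u, k (r.onV u) = ⟨u = x⟩ := ConcreteCategory.congr_hom (h.nodes.inl_desc p q w)
  have := (hk x).symm.trans ((congrArg k hxx).trans (hk x'))
  exact ((ULift.ext_iff.1 this).mp rfl).symm

/-- Only an edge from `X` needs an argument: its endpoints in the image of `b` come from `A`, since
a pushout of sets along an injection is a pullback; closedness of `t` then puts the edge in `A`. -/
lemma isClosedEmb (h : IsNodePushout t l r b) (w : t ≫ r = l ≫ b) (ht : IsClosedEmb a t) :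
    IsClosedEmb a b := by
  refine ⟨h.injective ht.1, ?_⟩
  rintro e hs ⟨y, hy⟩
  obtain ⟨e, rfl⟩ | ⟨e, rfl⟩ := h.edges e
  · rw [r.map_t] at hy
    obtain ⟨x, hx, -⟩ := h.exists_of_eq ht.1 hy.symm
    obtain ⟨e, rfl⟩ := ht.2 e (hs.imp_right fun ⟨y', hy'⟩ => by
      rw [r.map_s] at hy'
      obtain ⟨x', hx', -⟩ := h.exists_of_eq ht.1 hy'.symm
      exact ⟨x', hx'⟩) ⟨x, hx⟩
    exact ⟨l.onE e, (congrFun (congrArg Hom.onE w) e).symm⟩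
  · exact ⟨e, rfl⟩

lemma isPushout_edges (h : IsNodePushout t l r b) (w : t ≫ r = l ≫ b) (hA : A.IsSimple)
    (hX : X.IsSimple) (hY : Y.IsSimple) (ht : IsClosedEmb a t) (hl : Function.Injective l.onV) :
    IsPushout (DirGraph.edges.map t) (DirGraph.edges.map l) (DirGraph.edges.map r)
      (DirGraph.edges.map b) := by
  have hr := onE_injective hX r (h.flip.injective hl)
  have hb := onE_injective hY b (h.injective ht.1)
  have wE : ∀ e, r.onE (t.onE e) = b.onE (l.onE e) := congrFun (congrArg Hom.onE w)
  have : Mono (DirGraph.edges.map r) := (mono_iff_injective _).2 hr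
  refine Types.isPushout_of_isPullback_of_mono' ?_ ?_ fun _ _ _ _ hxy => hb hxy
  · rw [Types.isPullback_iff]
    refine ⟨by rw [← Functor.map_comp, w, Functor.map_comp], ?_, ?_⟩
    · exact fun e e' he => onE_injective hA t ht.1 he.1
    · intro (e : X.E) (e' : Y.E) he
      replace he : r.onE e = b.onE e' := he
      obtain ⟨x, hx, -⟩ := h.exists_of_eq ht.1 (x := X.t e) (y := Y.t e')
        (by rw [← r.map_t, ← b.map_t, he])
      obtain ⟨y, hy, -⟩ := h.exists_of_eq ht.1 (x := X.s e) (y := Y.s e')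
        (by rw [← r.map_s, ← b.map_s, he])
      obtain ⟨e, rfl⟩ := ht.2 e (Or.inr ⟨y, hy⟩) ⟨x, hx⟩
      exact ⟨e, rfl, hb ((wE e).symm.trans he)⟩
  · refine Set.eq_univ_of_forall fun e => ?_
    exact h.edges e

end IsNodePushout

end DirGraph

/-! ### Construction of pushouts of simple graphs -/

namespace DirGraph

section

variable {A X Y : DirGraph.{w}} (t : A ⟶ X) (l : A ⟶ Y)

/-- The pushout of two morphisms of simple graphs: the pushout of the sets of nodes, with an edge
for each pair of nodes which are the endpoints of the image of an edge. -/
noncomputable def pushoutGraph : DirGraph.{w} where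
  E := { p : ↑(pushout (nodes.map t) (nodes.map l)) × ↑(pushout (nodes.map t) (nodes.map l)) //
    (∃ e, (pushout.inl (nodes.map t) (nodes.map l) (X.s e),
      pushout.inl (nodes.map t) (nodes.map l) (X.t e)) = p) ∨
    ∃ e, (pushout.inr (nodes.map t) (nodes.map l) (Y.s e),
      pushout.inr (nodes.map t) (nodes.map l) (Y.t e)) = p }
  V := ↑(pushout (nodes.map t) (nodes.map l))
  s p := p.1.1
  t p := p.1.2

lemma pushoutGraph_isSimple : (pushoutGraph t l).IsSimple :=
  fun _ _ hs ht => Subtype.ext (Prod.ext hs ht)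

/-- The first inclusion into the pushout of two morphisms of simple graphs. -/
noncomputable def pushoutGraphInl : X ⟶ pushoutGraph t l where
  onE e := ⟨(_, _), Or.inl ⟨e, rfl⟩⟩
  onV := pushout.inl (nodes.map t) (nodes.map l)
  map_s _ := rfl
  map_t _ := rfl

/-- The second inclusion into the pushout of two morphisms of simple graphs. -/
noncomputable def pushoutGraphInr : Y ⟶ pushoutGraph t l where
  onE e := ⟨(_, _), Or.inr ⟨e, rfl⟩⟩
  onV := pushout.inr (nodes.map t) (nodes.map l)
  map_s _ := rfl
  map_t _ := rfl

lemma isNodePushout_pushoutGraph :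
    IsNodePushout t l (pushoutGraphInl t l) (pushoutGraphInr t l) where
  nodes := IsPushout.of_hasPushout _ _
  edges := by
    rintro ⟨p, ⟨e, rfl⟩ | ⟨e, rfl⟩⟩
    · exact Or.inl ⟨e, rfl⟩
    · exact Or.inr ⟨e, rfl⟩

lemma pushoutGraph_condition : t ≫ pushoutGraphInl t l = l ≫ pushoutGraphInr t l :=
  hom_ext_of_isSimple (pushoutGraph_isSimple t l) (isNodePushout_pushoutGraph t l).comm_onV

end

/-! ### Acyclic graphs -/

/-- Two nodes are adjacent if there is an edge from the first to the second. -/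
def Adj (G : DirGraph.{w}) (x y : G.V) : Prop := ∃ e, G.s e = x ∧ G.t e = y

lemma transGen_of_isPath {G : DirGraph.{w}} (l : List G.E) (hl : l ≠ [])
    (h : l.IsChain (fun e e' => G.t e = G.s e')) :
    Relation.TransGen G.Adj (G.s (l.head hl)) (G.t (l.getLast hl)) := by
  induction l with
  | nil => exact absurd rfl hl
  | cons e l ih =>
    cases l with
    | nil => exact .single ⟨e, rfl, rfl⟩
    | cons e' l =>
      rw [List.isChain_cons_cons] at h
      have := ih (by simp) h.2
      rw [List.head_cons, ← h.1] at this
      exact .head ⟨e, rfl, rfl⟩ this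

lemma exists_isPath_of_transGen {G : DirGraph.{w}} {x y : G.V}
    (h : Relation.TransGen G.Adj x y) :
    ∃ (l : List G.E) (hl : l ≠ []), l.IsChain (fun e e' => G.t e = G.s e') ∧
      G.s (l.head hl) = x ∧ G.t (l.getLast hl) = y := by
  induction h using Relation.TransGen.head_induction_on with
  | single h =>
    obtain ⟨e, hs, ht⟩ := h
    exact ⟨[e], by simp, by simp, hs, ht⟩
  | head h _ ih =>
    obtain ⟨e, hs, ht⟩ := h
    obtain ⟨l, hl, hc, hs', ht'⟩ := ih
    obtain ⟨e', l, rfl⟩ := List.exists_cons_of_ne_nil hl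
    exact ⟨e :: e' :: l, by simp, List.isChain_cons_cons.2 ⟨ht.trans hs'.symm, hc⟩, hs, ht'⟩

/-- Turns lists of edges into a relation, so that acyclicity can be proved by induction on
`TransGen`. -/
lemma forall_not_isCycle_iff {G : DirGraph.{w}} :
    (∀ l : List G.E, ¬ G.IsCycle l) ↔ ∀ x, ¬ Relation.TransGen G.Adj x x := by
  refine ⟨fun h x hx => ?_, fun h l hl => ?_⟩
  · obtain ⟨l, hl, hc, hs, ht⟩ := exists_isPath_of_transGen hx
    exact h l ⟨⟨hl, hc⟩, hl, hs.trans ht.symm⟩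
  · obtain ⟨⟨hl, hc⟩, _, hst⟩ := hl
    have := transGen_of_isPath l hl hc
    rw [hst] at this
    exact h _ this

lemma Adj.map {G H : DirGraph.{w}} (f : G ⟶ H) {x y : G.V} (h : G.Adj x y) :
    H.Adj (f.onV x) (f.onV y) := by
  obtain ⟨e, rfl, rfl⟩ := h
  exact ⟨f.onE e, f.map_s e, f.map_t e⟩

lemma IsDAG.of_hom {G H : DirGraph.{w}} (f : G ⟶ H) (hG : G.IsSimple) (hH : H.IsDAG) :
    G.IsDAG :=
  ⟨hG, forall_not_isCycle_iff.2 fun _ hx =>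
    forall_not_isCycle_iff.1 hH.2 _ (hx.lift f.onV fun _ _ => Adj.map f)⟩

/-- The pushout of a downward closed morphism of acyclic graphs is acyclic. -/
lemma IsNodePushout.isDAG {A X Y Z : DirGraph.{w}} {t : A ⟶ X} {l : A ⟶ Y} {r : X ⟶ Z} {b : Y ⟶ Z}
    (h : IsNodePushout t l r b) (w : t ≫ r = l ≫ b) (ht : IsClosedEmb True t)
    (hX : X.IsDAG) (hY : Y.IsDAG) (hZ : Z.IsSimple) : Z.IsDAG := by
  refine ⟨hZ, forall_not_isCycle_iff.2 ?_⟩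
  have hb := h.isClosedEmb w ht
  have adj_b : ∀ {z y}, Z.Adj z (b.onV y) → ∃ y', b.onV y' = z ∧ Y.Adj y' y := by
    rintro z y ⟨e, rfl, he⟩
    obtain ⟨e, rfl⟩ := hb.2 e (Or.inl trivial) ⟨y, he.symm⟩
    exact ⟨Y.s e, (b.map_s e).symm, e, rfl, hb.1 (by rw [← he, b.map_t])⟩
  -- Induction backwards from the endpoint: downward closedness keeps every earlier node in the
  -- image of `b`.
  have trans_b : ∀ {z y}, Relation.TransGen Z.Adj z (b.onV y) →
      ∃ y', b.onV y' = z ∧ Relation.TransGen Y.Adj y' y := by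
    intro z y hz
    induction hz using Relation.TransGen.head_induction_on with
    | single h =>
      obtain ⟨y', hy, h⟩ := adj_b h
      exact ⟨y', hy, .single h⟩
    | head h _ ih =>
      obtain ⟨y', rfl, ih⟩ := ih
      obtain ⟨y'', hy, h⟩ := adj_b h
      exact ⟨y'', hy, .head h ih⟩
  have adj_r : ∀ {z z'}, Z.Adj z z' → z ∉ Set.range b.onV →
      ∃ x x', r.onV x = z ∧ r.onV x' = z' ∧ X.Adj x x' := by
    rintro _ _ ⟨e, rfl, rfl⟩ hz
    obtain ⟨e, rfl⟩ | ⟨e, rfl⟩ := h.edges e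
    · exact ⟨_, _, (r.map_s e).symm, (r.map_t e).symm, e, rfl, rfl⟩
    · exact absurd ⟨_, (b.map_s e).symm⟩ hz
  -- By `trans_b`, a path starting outside the image of `b` never enters it; `r` is injective over
  -- that complement, so the lifted edges fit together.
  have trans_r : ∀ {z z'}, Relation.TransGen Z.Adj z z' → z ∉ Set.range b.onV →
      ∃ x x', r.onV x = z ∧ r.onV x' = z' ∧ Relation.TransGen X.Adj x x' := by
    intro z z' hz hzb
    induction hz with
    | single h =>
      obtain ⟨x, x', hx, hx', h⟩ := adj_r h hzb
      exact ⟨x, x', hx, hx', .single h⟩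
    | @tail z₁ z₂ hz₁ hz₂ ih =>
      have hz₁b : z₁ ∉ Set.range b.onV := by
        rintro ⟨y, rfl⟩
        obtain ⟨y', hy, -⟩ := trans_b hz₁
        exact hzb ⟨y', hy⟩
      obtain ⟨x, x', hx, hx', ih⟩ := ih
      obtain ⟨x₁, x₂, hx₁, hx₂, h'⟩ := adj_r hz₂ hz₁b
      obtain rfl : x' = x₁ := h.eq_of_eq (hx'.trans hx₁.symm) (by rwa [hx'])
      exact ⟨x, x₂, hx, hx₂, .tail ih h'⟩
  intro z hz
  by_cases hzb : z ∈ Set.range b.onV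
  · obtain ⟨y, rfl⟩ := hzb
    obtain ⟨y', hy, h'⟩ := trans_b hz
    obtain rfl := hb.1 hy
    exact forall_not_isCycle_iff.1 hY.2 _ h'
  · obtain ⟨x, x', hx, hx', h'⟩ := trans_r hz hzb
    obtain rfl : x = x' := h.eq_of_eq (hx.trans hx'.symm) (by rwa [hx])
    exact forall_not_isCycle_iff.1 hX.2 _ h'

end DirGraph

/-! ## Hypergraphs over a class of simple graphs -/

/-- With `List.eq_of_map_eq`, this says that the Kleene star preserves pullbacks: words with equal
images pair up letter by letter. -/
lemma List.exists_map_pullback {α β γ : Type*} {f : α → γ} {g : β → γ} (l : List α) (m : List β)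
    (h : l.map f = m.map g) :
    ∃ n : List { p : α × β // f p.1 = g p.2 }, n.map (fun p => p.1.1) = l ∧
      n.map (fun p => p.1.2) = m := by
  induction l generalizing m with
  | nil => exact ⟨[], rfl, by simpa using h⟩
  | cons x l ih =>
    cases m with
    | nil => simp at h
    | cons y m =>
      rw [List.map_cons, List.map_cons, List.cons.injEq] at h
      obtain ⟨n, rfl, rfl⟩ := ih m h.2
      exact ⟨⟨(x, y), h.1⟩ :: n, rfl, rfl⟩

lemma List.eq_of_map_eq {α β γ : Type*} {f : α → β} {g : α → γ}
    (h : ∀ x y, f x = f y → g x = g y → x = y) (l m : List α) (hf : l.map f = m.map f)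
    (hg : l.map g = m.map g) : l = m := by
  induction l generalizing m with
  | nil => simpa using hf
  | cons x l ih =>
    cases m with
    | nil => simp at hf
    | cons y m =>
      rw [List.map_cons, List.map_cons, List.cons.injEq] at hf hg
      rw [h x y hf.1 hg.1, ih m hf.2 hg.2]

/-! ### Functors that preserve one chosen pullback or pushout of a diagram -/

namespace CategoryTheory

lemma IsPullback.map_of_comparison {C : Type*} {D : Type*} [Category C] [Category D] (F : C ⥤ D)
    {A A' X Y Z : C} {t : A ⟶ X} {l : A ⟶ Y} {r : X ⟶ Z} {b : Y ⟶ Z} {t' : A' ⟶ X} {l' : A' ⟶ Y}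
    (h : IsPullback t l r b) (h' : IsPullback t' l' r b)
    (hF : IsPullback (F.map t') (F.map l') (F.map r) (F.map b)) :
    IsPullback (F.map t) (F.map l) (F.map r) (F.map b) :=
  hF.of_iso (F.mapIso (h'.isoIsPullback _ _ h)) (Iso.refl _) (Iso.refl _) (Iso.refl _)
    (by simp [← Functor.map_comp]) (by simp [← Functor.map_comp]) (by simp) (by simp)

lemma IsPushout.map_of_comparison {C : Type*} {D : Type*} [Category C] [Category D] (F : C ⥤ D)
    {A X Y Z Z' : C} {t : A ⟶ X} {l : A ⟶ Y} {r : X ⟶ Z} {b : Y ⟶ Z} {r' : X ⟶ Z'} {b' : Y ⟶ Z'}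
    (h : IsPushout t l r b) (h' : IsPushout t l r' b')
    (hF : IsPushout (F.map t) (F.map l) (F.map r') (F.map b')) :
    IsPushout (F.map t) (F.map l) (F.map r) (F.map b) :=
  hF.of_iso (Iso.refl _) (Iso.refl _) (Iso.refl _) (F.mapIso (h'.isoIsPushout _ _ h))
    (by simp) (by simp) (by simp [← Functor.map_comp]) (by simp [← Functor.map_comp])

end CategoryTheory

/-- The category of hypergraphs whose hyperedges are the nodes of a graph satisfying `P`. -/
abbrev HGraph (P : ObjectProperty DirGraph.{w}) : Type (w + 1) :=
  Comma (P.ι ⋙ DirGraph.nodes) kleeneStar.{w}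

/-- A property of graphs is admissible if it implies simplicity and is inherited by every simple
graph with a morphism to a graph with the property. -/
structure IsAdmissible (P : ObjectProperty DirGraph.{w}) : Prop where
  isSimple {G : DirGraph.{w}} : P G → G.IsSimple
  of_hom {G H : DirGraph.{w}} : (G ⟶ H) → G.IsSimple → P H → P G

namespace HGraph

open DirGraph

variable {P : ObjectProperty DirGraph.{w}} {X Y Z : HGraph P}

/-- The graph of hyperedges. -/
abbrev graph (X : HGraph P) : DirGraph.{w} := X.left.obj

/-- The word of nodes of a hyperedge. -/
def word (X : HGraph P) : X.graph.V → List X.right := X.hom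

/-- The morphism of graphs underlying a morphism of hypergraphs. -/
abbrev graphMap (f : X ⟶ Y) : X.graph ⟶ Y.graph := f.left.hom

lemma word_onV (f : X ⟶ Y) (x : X.graph.V) :
    Y.word ((graphMap f).onV x) = (X.word x).map f.right :=
  ConcreteCategory.congr_hom f.w x

/-- Constructor for hypergraphs. -/
def mk (G : DirGraph.{w}) (hG : P G) (W : Type w) (e : G.V → List W) : HGraph P where
  left := ⟨G, hG⟩
  right := W
  hom := TypeCat.ofHom e

/-- Constructor for morphisms of hypergraphs. -/
def homMk (f : X.graph ⟶ Y.graph) (k : X.right ⟶ Y.right)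
    (h : ∀ x, Y.word (f.onV x) = (X.word x).map k) : X ⟶ Y where
  left := ObjectProperty.homMk f
  right := k
  w := ConcreteCategory.hom_ext _ _ h

lemma hom_ext {f g : X ⟶ Y} (h : graphMap f = graphMap g) (h' : f.right = g.right) : f = g :=
  CommaMorphism.ext (ObjectProperty.hom_ext _ h) h'

variable (P) in
/-- The functor sending a hypergraph to its graph of hyperedges. -/
abbrev toGraph : HGraph P ⥤ DirGraph.{w} := Comma.fst _ _ ⋙ P.ι

variable (P) in
/-- The functor sending a hypergraph to its set of nodes. -/
abbrev nodeSet : HGraph P ⥤ Type w := Comma.snd _ _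

/-! ### Pullbacks -/

/-- A square of hypergraphs which is a pullback square of sets componentwise. -/
structure IsSetPullback {A X Y Z : HGraph P} (t : A ⟶ X) (l : A ⟶ Y) (r : X ⟶ Z)
    (b : Y ⟶ Z) : Prop where
  edges : IsPullback (edges.map (graphMap t)) (edges.map (graphMap l)) (edges.map (graphMap r))
    (edges.map (graphMap b))
  nodes : IsPullback (nodes.map (graphMap t)) (nodes.map (graphMap l)) (nodes.map (graphMap r))
    (nodes.map (graphMap b))
  nodeSet : IsPullback t.right l.right r.right b.right

variable {A X Y Z : HGraph P} {t : A ⟶ X} {l : A ⟶ Y} {r : X ⟶ Z} {b : Y ⟶ Z}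

/-- The three set-level lifts form a morphism: sources, targets and words in `A` are determined by
their projections to `X` and `Y`, where the compatibilities hold. -/
lemma IsSetPullback.isPullback (h : IsSetPullback t l r b) : IsPullback t l r b := by
  have w : t ≫ r = l ≫ b := by
    refine hom_ext (DirGraph.hom_ext ?_ ?_) h.nodeSet.w
    · exact ConcreteCategory.congr_hom h.edges.w
    · exact ConcreteCategory.congr_hom h.nodes.w
  have extE : ∀ e e', (graphMap t).onE e = (graphMap t).onE e' →
      (graphMap l).onE e = (graphMap l).onE e' → e = e' :=
    fun _ _ h₁ h₂ => Types.ext_of_isPullback h.edges h₁ h₂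
  have extV : ∀ x x', (graphMap t).onV x = (graphMap t).onV x' →
      (graphMap l).onV x = (graphMap l).onV x' → x = x' :=
    fun _ _ h₁ h₂ => Types.ext_of_isPullback h.nodes h₁ h₂
  have extW : ∀ x x', t.right x = t.right x' → l.right x = l.right x' → x = x' :=
    fun _ _ h₁ h₂ => Types.ext_of_isPullback h.nodeSet h₁ h₂
  have lift : ∀ (S : HGraph P) (f : S ⟶ X) (g : S ⟶ Y), f ≫ r = g ≫ b →
      ∃ φ : S ⟶ A, φ ≫ t = f ∧ φ ≫ l = g := by
    intro S f g hfg
    have hg : graphMap f ≫ graphMap r = graphMap g ≫ graphMap b :=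
      congrArg (fun k : S ⟶ Z => graphMap k) hfg
    have hk : f.right ≫ r.right = g.right ≫ b.right :=
      congrArg CommaMorphism.right hfg
    choose φE hE hE' using fun e => Types.exists_of_isPullback h.edges
      ((graphMap f).onE e) ((graphMap g).onE e) (congrFun (congrArg Hom.onE hg) e)
    choose φV hV hV' using fun x => Types.exists_of_isPullback h.nodes
      ((graphMap f).onV x) ((graphMap g).onV x) (congrFun (congrArg Hom.onV hg) x)
    let φW := h.nodeSet.lift _ _ hk
    have hW : φW ≫ t.right = f.right := h.nodeSet.lift_fst _ _ hk
    have hW' : φW ≫ l.right = g.right := h.nodeSet.lift_snd _ _ hk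
    let φ : S.graph ⟶ A.graph :=
      { onE := φE
        onV := φV
        map_s := fun e => extV _ _
          ((((graphMap t).map_s _).symm.trans ((congrArg _ (hE e)).trans
            ((graphMap f).map_s e))).trans (hV _).symm)
          ((((graphMap l).map_s _).symm.trans ((congrArg _ (hE' e)).trans
            ((graphMap g).map_s e))).trans (hV' _).symm)
        map_t := fun e => extV _ _
          ((((graphMap t).map_t _).symm.trans ((congrArg _ (hE e)).trans
            ((graphMap f).map_t e))).trans (hV _).symm)
          ((((graphMap l).map_t _).symm.trans ((congrArg _ (hE' e)).trans
            ((graphMap g).map_t e))).trans (hV' _).symm) }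
    refine ⟨homMk φ φW fun x => List.eq_of_map_eq extW _ _ ?_ ?_,
      hom_ext (DirGraph.hom_ext hE hV) hW, hom_ext (DirGraph.hom_ext hE' hV') hW'⟩
    · rw [← word_onV, List.map_map]
      have : X.word ((graphMap t).onV (φ.onV x)) = X.word ((graphMap f).onV x) :=
        congrArg X.word (hV x)
      rw [this, word_onV, ← hW]
      rfl
    · rw [← word_onV, List.map_map]
      have : Y.word ((graphMap l).onV (φ.onV x)) = Y.word ((graphMap g).onV x) :=
        congrArg Y.word (hV' x)
      rw [this, word_onV, ← hW']
      rfl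
  choose φ h₁ h₂ using lift
  refine ⟨⟨w⟩, ⟨PullbackCone.IsLimit.mk w (fun s => φ _ s.fst s.snd s.condition)
    (fun s => h₁ ..) (fun s => h₂ ..) fun s m hm hm' => ?_⟩⟩
  have e₁ : m ≫ t = φ _ s.fst s.snd s.condition ≫ t := by rw [hm, h₁]
  have e₂ : m ≫ l = φ _ s.fst s.snd s.condition ≫ l := by rw [hm', h₂]
  have g₁ := congrArg (fun k : s.pt ⟶ X => graphMap k) e₁
  have g₂ := congrArg (fun k : s.pt ⟶ Y => graphMap k) e₂
  refine hom_ext (DirGraph.hom_ext (fun e => extE _ _ ?_ ?_) fun x => extV _ _ ?_ ?_) ?_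
  · exact congrFun (congrArg Hom.onE g₁) e
  · exact congrFun (congrArg Hom.onE g₂) e
  · exact congrFun (congrArg Hom.onV g₁) x
  · exact congrFun (congrArg Hom.onV g₂) x
  · exact h.nodeSet.hom_ext (congrArg CommaMorphism.right e₁) (congrArg CommaMorphism.right e₂)

lemma exists_isSetPullback (hP : IsAdmissible P) (r : X ⟶ Z) (b : Y ⟶ Z) :
    ∃ (A : HGraph P) (t : A ⟶ X) (l : A ⟶ Y), IsSetPullback t l r b := by
  let G : DirGraph.{w} :=
    { E := { p : X.graph.E × Y.graph.E // (graphMap r).onE p.1 = (graphMap b).onE p.2 }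
      V := { p : X.graph.V × Y.graph.V // (graphMap r).onV p.1 = (graphMap b).onV p.2 }
      s := fun p => ⟨(X.graph.s p.1.1, Y.graph.s p.1.2), by
        rw [← (graphMap r).map_s, ← (graphMap b).map_s, p.2]⟩
      t := fun p => ⟨(X.graph.t p.1.1, Y.graph.t p.1.2), by
        rw [← (graphMap r).map_t, ← (graphMap b).map_t, p.2]⟩ }
  let t : G ⟶ X.graph := ⟨fun p => p.1.1, fun p => p.1.1, fun _ => rfl, fun _ => rfl⟩
  let l : G ⟶ Y.graph := ⟨fun p => p.1.2, fun p => p.1.2, fun _ => rfl, fun _ => rfl⟩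
  have hG : G.IsSimple := fun e e' hs ht => Subtype.ext (Prod.ext
    (hP.isSimple X.left.property _ _ (congrArg t.onV hs) (congrArg t.onV ht))
    (hP.isSimple Y.left.property _ _ (congrArg l.onV hs) (congrArg l.onV ht)))
  choose word hword hword' using fun p : G.V =>
    List.exists_map_pullback (X.word p.1.1) (Y.word p.1.2)
      (by rw [← word_onV, ← word_onV, p.2] : _ = List.map b.right _)
  let A := mk G (hP.of_hom t hG X.left.property) _ word
  refine ⟨A, homMk t (TypeCat.ofHom fun p => p.1.1) fun p => (hword p).symm,
    homMk l (TypeCat.ofHom fun p => p.1.2) fun p => (hword' p).symm, ?_, ?_, ?_⟩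
  all_goals
    rw [Types.isPullback_iff]
    refine ⟨?_, fun p q h => Subtype.ext (Prod.ext h.1 h.2), fun x y h => ⟨⟨(x, y), h⟩, rfl, rfl⟩⟩
    ext p
    exact p.2

lemma isPullback_iff (hP : IsAdmissible P) : IsPullback t l r b ↔ IsSetPullback t l r b := by
  refine ⟨fun h => ?_, IsSetPullback.isPullback⟩
  obtain ⟨A', t', l', h'⟩ := exists_isSetPullback hP r b
  exact ⟨h.map_of_comparison (toGraph P ⋙ edges) h'.isPullback h'.edges,
    h.map_of_comparison (toGraph P ⋙ nodes) h'.isPullback h'.nodes,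
    h.map_of_comparison (nodeSet P) h'.isPullback h'.nodeSet⟩

/-! ### Pushouts -/

/-- Hyperedges from `X` and `Y` cover those of `Z`, so compatibility of the induced map with words
is checked on each side; the Kleene star need not preserve pushouts. -/
lemma isPushout_of_isNodePushout (hP : IsAdmissible P) (w : t ≫ r = l ≫ b)
    (h : IsNodePushout (graphMap t) (graphMap l) (graphMap r) (graphMap b))
    (h' : IsPushout t.right l.right r.right b.right) : IsPushout t l r b := by
  have desc : ∀ (S : HGraph P) (f : X ⟶ S) (g : Y ⟶ S), t ≫ f = l ≫ g →
      ∃ φ : Z ⟶ S, r ≫ φ = f ∧ b ≫ φ = g := by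
    intro S f g hfg
    obtain ⟨φ, hr, hb⟩ := h.exists_desc (hP.isSimple S.left.property) (graphMap f) (graphMap g)
      (congrArg (fun k : A ⟶ S => graphMap k) hfg)
    have hk : t.right ≫ f.right = l.right ≫ g.right := congrArg CommaMorphism.right hfg
    let k := h'.desc _ _ hk
    have hr' : r.right ≫ k = f.right := h'.inl_desc _ _ hk
    have hb' : b.right ≫ k = g.right := h'.inr_desc _ _ hk
    refine ⟨homMk φ k fun x => ?_, hom_ext hr hr', hom_ext hb hb'⟩
    obtain ⟨y, rfl⟩ | ⟨y, rfl⟩ : (∃ y, (graphMap r).onV y = x) ∨ ∃ y, (graphMap b).onV y = x :=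
      Types.eq_or_eq_of_isPushout h.nodes x
    · rw [← comp_onV, hr, word_onV, word_onV, List.map_map, ← hr']
      rfl
    · rw [← comp_onV, hb, word_onV, word_onV, List.map_map, ← hb']
      rfl
  choose φ h₁ h₂ using desc
  refine ⟨⟨w⟩, ⟨PushoutCocone.IsColimit.mk w (fun s => φ _ s.inl s.inr s.condition)
    (fun s => h₁ ..) (fun s => h₂ ..) fun s m hm hm' => ?_⟩⟩
  have e₁ : r ≫ m = r ≫ φ _ s.inl s.inr s.condition := by rw [hm, h₁]
  have e₂ : b ≫ m = b ≫ φ _ s.inl s.inr s.condition := by rw [hm', h₂]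
  refine hom_ext (hom_ext_of_isSimple (hP.isSimple s.pt.left.property) fun x => ?_)
    (h'.hom_ext (congrArg CommaMorphism.right e₁) (congrArg CommaMorphism.right e₂))
  obtain ⟨y, rfl⟩ | ⟨y, rfl⟩ : (∃ y, (graphMap r).onV y = x) ∨ ∃ y, (graphMap b).onV y = x :=
    Types.eq_or_eq_of_isPushout h.nodes x
  · exact congrArg (fun k : X ⟶ s.pt => (graphMap k).onV y) e₁
  · exact congrArg (fun k : Y ⟶ s.pt => (graphMap k).onV y) e₂

lemma exists_isNodePushout (t : A ⟶ X) (l : A ⟶ Y)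
    (h : P (pushoutGraph (graphMap t) (graphMap l))) :
    ∃ (Z : HGraph P) (r : X ⟶ Z) (b : Y ⟶ Z), t ≫ r = l ≫ b ∧
      IsNodePushout (graphMap t) (graphMap l) (graphMap r) (graphMap b) ∧
      IsPushout t.right l.right r.right b.right := by
  have hn := isNodePushout_pushoutGraph (graphMap t) (graphMap l)
  have hw : nodes.map (graphMap t) ≫ X.hom ≫ kleeneStar.map (pushout.inl t.right l.right) =
      nodes.map (graphMap l) ≫ Y.hom ≫ kleeneStar.map (pushout.inr t.right l.right) := by
    have ht : nodes.map (graphMap t) ≫ X.hom = A.hom ≫ kleeneStar.map t.right := t.w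
    have hl : nodes.map (graphMap l) ≫ Y.hom = A.hom ≫ kleeneStar.map l.right := l.w
    rw [reassoc_of% ht, reassoc_of% hl, ← Functor.map_comp, pushout.condition, Functor.map_comp]
  let e := hn.nodes.desc _ _ hw
  have he : nodes.map (pushoutGraphInl _ _) ≫ e = _ := hn.nodes.inl_desc _ _ hw
  have he' : nodes.map (pushoutGraphInr _ _) ≫ e = _ := hn.nodes.inr_desc _ _ hw
  exact ⟨mk _ h (pushout t.right l.right) e,
    homMk (pushoutGraphInl _ _) (pushout.inl _ _) (ConcreteCategory.congr_hom he),
    homMk (pushoutGraphInr _ _) (pushout.inr _ _) (ConcreteCategory.congr_hom he'),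
    hom_ext (pushoutGraph_condition _ _) pushout.condition, hn, .of_hasPushout _ _⟩

/-- This covers every existing pushout, as stability of `M` and `N` demands. `pushoutGraph` maps to
the graph of `Z`, so it satisfies `P` by admissibility; the explicit pushout thus exists in `HGraph
P` and is isomorphic to `Z`. -/
lemma isNodePushout (hP : IsAdmissible P) (h : IsPushout t l r b) :
    IsNodePushout (graphMap t) (graphMap l) (graphMap r) (graphMap b) ∧
      IsPushout t.right l.right r.right b.right := by
  obtain ⟨φ, -, -⟩ := (isNodePushout_pushoutGraph (graphMap t) (graphMap l)).exists_desc
    (hP.isSimple Z.left.property) (graphMap r) (graphMap b)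
    (congrArg (fun k : A ⟶ Z => graphMap k) h.w)
  obtain ⟨Z', r', b', w, hn, hs⟩ := exists_isNodePushout t l
    (hP.of_hom φ (pushoutGraph_isSimple _ _) Z.left.property)
  have h' := isPushout_of_isNodePushout hP w hn hs
  refine ⟨⟨h.map_of_comparison (toGraph P ⋙ nodes) h' hn.nodes, fun e => ?_⟩,
    h.map_of_comparison (nodeSet P) h' hs⟩
  let i := h'.isoIsPushout _ _ h
  have hi : ∀ e, (graphMap i.hom).onE ((graphMap i.inv).onE e) = e :=
    congrFun (congrArg (fun k : Z ⟶ Z => (graphMap k).onE) i.inv_hom_id)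
  rw [← hi e]
  refine (hn.edges ((graphMap i.inv).onE e)).imp ?_ ?_
  · rintro ⟨x, hx⟩
    rw [← hx, ← h'.inl_isoIsPushout_hom _ _ h]
    exact ⟨x, rfl⟩
  · rintro ⟨x, hx⟩
    rw [← hx, ← h'.inr_isoIsPushout_hom _ _ h]
    exact ⟨x, rfl⟩

end HGraph

namespace HGraph

open DirGraph

variable {P : ObjectProperty DirGraph.{w}} {A X Y Z : HGraph P}

/-! ### Adhesivity -/

/-- Morphisms which are a closed embedding of graphs and injective on nodes. -/
def closedEmb (P : ObjectProperty DirGraph.{w}) (a : Prop) : MorphismProperty (HGraph P) :=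
  fun _ _ f => IsClosedEmb a (graphMap f) ∧ Function.Injective f.right

/-- Morphisms which are injective on hyperedges. -/
def graphInjective (P : ObjectProperty DirGraph.{w}) : MorphismProperty (HGraph P) :=
  fun _ _ f => Function.Injective (graphMap f).onV

variable {t : A ⟶ X} {l : A ⟶ Y} {r : X ⟶ Z} {b : Y ⟶ Z} {a : Prop}

lemma isSetPushout (hP : IsAdmissible P) (h : IsPushout t l r b) (ht : closedEmb P a t)
    (hl : graphInjective P l) :
    IsPushout (edges.map (graphMap t)) (edges.map (graphMap l)) (edges.map (graphMap r))
      (edges.map (graphMap b)) ∧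
    IsPushout (nodes.map (graphMap t)) (nodes.map (graphMap l)) (nodes.map (graphMap r))
      (nodes.map (graphMap b)) ∧
    IsPushout t.right l.right r.right b.right := by
  obtain ⟨hn, hs⟩ := isNodePushout hP h
  exact ⟨hn.isPushout_edges (congrArg (fun k : A ⟶ Z => graphMap k) h.w)
    (hP.isSimple A.left.property) (hP.isSimple X.left.property) (hP.isSimple Y.left.property)
    ht.1 hl, hn.nodes, hs⟩

lemma isPushout_of_isSetPushout (hP : IsAdmissible P) (w : t ≫ r = l ≫ b)
    (hE : IsPushout (edges.map (graphMap t)) (edges.map (graphMap l)) (edges.map (graphMap r))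
      (edges.map (graphMap b)))
    (hV : IsPushout (nodes.map (graphMap t)) (nodes.map (graphMap l)) (nodes.map (graphMap r))
      (nodes.map (graphMap b)))
    (hW : IsPushout t.right l.right r.right b.right) : IsPushout t l r b :=
  isPushout_of_isNodePushout hP w ⟨hV, Types.eq_or_eq_of_isPushout hE⟩ hW

lemma closedEmb_of_isPullback (hP : IsAdmissible P) (h : IsPullback t l r b)
    (hr : closedEmb P a r) : closedEmb P a l := by
  have h' := (isPullback_iff hP).1 h
  refine ⟨.of_isPullback h'.edges h'.nodes hr.1, fun x y hxy =>
    Types.ext_of_isPullback h'.nodeSet (hr.2 ?_) hxy⟩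
  have w : ∀ x, r.right (t.right x) = b.right (l.right x) := ConcreteCategory.congr_hom h'.nodeSet.w
  rw [w, w, hxy]

lemma graphInjective_of_isPullback (hP : IsAdmissible P) (h : IsPullback t l r b)
    (hr : graphInjective P r) : graphInjective P l := by
  have h' := ((isPullback_iff hP).1 h).nodes
  have w : ∀ x, (graphMap r).onV ((graphMap t).onV x) = (graphMap b).onV ((graphMap l).onV x) :=
    ConcreteCategory.congr_hom h'.w
  refine fun x y hxy => Types.ext_of_isPullback h' (hr ?_) hxy
  exact (w x).trans ((congrArg _ hxy).trans (w y).symm)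

lemma closedEmb_le_monomorphisms (hP : IsAdmissible P) :
    closedEmb P a ≤ MorphismProperty.monomorphisms (HGraph P) := fun A B f hf => by
  refine ⟨fun g h hgh => hom_ext ?_ ?_⟩
  · have := mono_of_injective (hP.isSimple A.left.property) hf.1.1
    exact (cancel_mono (graphMap f)).1 (congrArg (fun k => graphMap k) hgh)
  · have : Mono f.right := (mono_iff_injective _).2 hf.2
    exact (cancel_mono f.right).1 (congrArg CommaMorphism.right hgh)

lemma closedEmb_of_isIso (f : X ⟶ Y) [IsIso f] : closedEmb P a f := by
  have h₁ : IsIso ((toGraph P).map f) := inferInstance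
  have h₂ : IsIso ((nodeSet P).map f) := inferInstance
  exact ⟨IsClosedEmb.of_isIso ((toGraph P).map f), (mono_iff_injective ((nodeSet P).map f)).1
    inferInstance⟩

lemma isVanKampen (hP : IsAdmissible P) (h : IsPushout t l r b) (ht : closedEmb P a t)
    (hl : graphInjective P l) : h.IsVanKampen := by
  intro A' X' Y' Z' t' l' r' b' αA αX αY αZ ht' hl' hr hb w
  have pt := (isPullback_iff hP).1 ht'
  have pl := (isPullback_iff hP).1 hl'
  obtain ⟨hE, hV, hW⟩ := isSetPushout hP h ht hl
  have mE : Mono (edges.map (graphMap t)) :=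
    (mono_iff_injective _).2 (onE_injective (hP.isSimple A.left.property) _ ht.1.1)
  have mV : Mono (nodes.map (graphMap t)) := (mono_iff_injective _).2 ht.1.1
  have mW : Mono t.right := (mono_iff_injective _).2 ht.2
  have kE := Adhesive.van_kampen hE _ _ _ _ _ _ _ _ pt.edges pl.edges
    (hr.map (toGraph P ⋙ edges)) (hb.map (toGraph P ⋙ edges)) (w.map (toGraph P ⋙ edges))
  have kV := Adhesive.van_kampen hV _ _ _ _ _ _ _ _ pt.nodes pl.nodes
    (hr.map (toGraph P ⋙ nodes)) (hb.map (toGraph P ⋙ nodes)) (w.map (toGraph P ⋙ nodes))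
  have kW := Adhesive.van_kampen hW _ _ _ _ _ _ _ _ pt.nodeSet pl.nodeSet
    (hr.map (nodeSet P)) (hb.map (nodeSet P)) (w.map (nodeSet P))
  constructor
  · intro h'
    -- The back faces are pullbacks, so the span of the top face is again in `M` and `N` and its
    -- pushout is componentwise.
    obtain ⟨hE', hV', hW'⟩ := isSetPushout hP h' (closedEmb_of_isPullback hP ht'.flip ht)
      (graphInjective_of_isPullback hP hl'.flip hl)
    exact ⟨IsSetPullback.isPullback ⟨(kE.1 hE').1, (kV.1 hV').1, (kW.1 hW').1⟩,
      IsSetPullback.isPullback ⟨(kE.1 hE').2, (kV.1 hV').2, (kW.1 hW').2⟩⟩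
  · rintro ⟨h₁, h₂⟩
    rw [isPullback_iff hP] at h₁ h₂
    exact isPushout_of_isSetPushout hP w.w (kE.2 ⟨h₁.edges, h₂.edges⟩)
      (kV.2 ⟨h₁.nodes, h₂.nodes⟩) (kW.2 ⟨h₁.nodeSet, h₂.nodeSet⟩)

theorem isMNAdhesive (hP : IsAdmissible P) (a : Prop)
    (hpo : ∀ {G H K : DirGraph.{w}} (f : G ⟶ H) (g : G ⟶ K), P H → P K → IsClosedEmb a f →
      Function.Injective g.onV → P (pushoutGraph f g)) :
    IsMNAdhesive (closedEmb P a) (graphInjective P) where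
  mono := closedEmb_le_monomorphisms hP
  isoM _ _ f (_ : IsIso f) := closedEmb_of_isIso f
  isoN _ _ f (_ : IsIso f) := (closedEmb_of_isIso (a := a) f).1.1
  compM := ⟨fun _ _ hf hg => ⟨hf.1.comp hg.1, hg.2.comp hf.2⟩⟩
  compN := ⟨fun _ _ hf hg _ _ h => hf (hg h)⟩
  decompM := ⟨fun {_ Y _} _ _ hg hfg => ⟨.of_comp (hP.isSimple Y.left.property) hg.1.1 hfg.1,
    Function.Injective.of_comp hfg.2⟩⟩
  decompN := ⟨fun _ _ _ hfg => Function.Injective.of_comp hfg⟩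
  decompNM := ⟨fun _ _ _ hfg => Function.Injective.of_comp hfg⟩
  pullbackM := ⟨fun sq hg => closedEmb_of_isPullback hP sq hg⟩
  pullbackN := ⟨fun sq hg => graphInjective_of_isPullback hP sq hg⟩
  pushoutM := ⟨fun {_ _ _ _ f _ _ _} sq hf => by
    obtain ⟨hn, hs⟩ := isNodePushout hP sq.flip
    have : Mono f.right := (mono_iff_injective _).2 hf.2
    exact ⟨hn.isClosedEmb (congrArg (fun k => graphMap k) sq.flip.w) hf.1,
      (mono_iff_injective _).1 (Adhesive.mono_of_isPushout_of_mono_left hs)⟩⟩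
  pushoutN := ⟨fun sq hf => (isNodePushout hP sq.flip).1.injective hf⟩
  hasPullback g m _ := by
    obtain ⟨_, _, _, h⟩ := exists_isSetPullback hP g m
    exact h.isPullback.hasPullback
  hasPushout {X Y Z} m n hm hn := by
    obtain ⟨_, _, _, w, h, h'⟩ := exists_isNodePushout m n
      (hpo _ _ Y.left.property Z.left.property hm.1 hn)
    exact (isPushout_of_isNodePushout hP w h h').hasPushout
  vanKampen sq hm hn := isVanKampen hP sq hm hn

/-! ### The left adjoint of the functor of nodes -/

/-- The graph without nodes. -/
def _root_.DirGraph.empty : DirGraph.{w} where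
  E := PEmpty
  V := PEmpty
  s := PEmpty.elim
  t := PEmpty.elim

/-- The morphism from the empty graph. -/
def _root_.DirGraph.emptyHom (G : DirGraph.{w}) : DirGraph.empty ⟶ G where
  onE := PEmpty.elim
  onV := PEmpty.elim
  map_s e := e.elim
  map_t e := e.elim

/-- The hypergraph with a given set of nodes and no hyperedges. -/
def discrete (hP : P DirGraph.empty) (W : Type w) : HGraph P :=
  mk DirGraph.empty hP W PEmpty.elim

/-- A morphism from a hypergraph without hyperedges is a function on nodes. -/
def discreteHomEquiv (hP : P DirGraph.empty) (W : Type w) (X : HGraph P) :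
    (discrete hP W ⟶ X) ≃ (W ⟶ (nodeSet P).obj X) where
  toFun f := f.right
  invFun k := homMk (DirGraph.emptyHom _) k fun x => PEmpty.elim x
  left_inv _ := hom_ext (DirGraph.hom_ext (fun e => PEmpty.elim e) fun x => PEmpty.elim x) rfl
  right_inv _ := rfl

lemma isRightAdjoint_nodeSet (hP : P DirGraph.empty) : (nodeSet P).IsRightAdjoint :=
  (Adjunction.adjunctionOfEquivLeft (discreteHomEquiv hP)
    fun _ _ _ _ _ => rfl).isRightAdjoint

end HGraph

/-! ## Monomorphisms and regular monomorphisms -/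

namespace DirGraph

variable {P : ObjectProperty DirGraph.{w}}

lemma isAdmissible_isSimple : IsAdmissible (fun G : DirGraph.{w} => G.IsSimple) :=
  ⟨id, fun _ h _ => h⟩

lemma isAdmissible_isDAG : IsAdmissible (fun G : DirGraph.{w} => G.IsDAG) :=
  ⟨And.left, IsDAG.of_hom⟩

lemma point_isDAG : point.{w}.IsDAG :=
  ⟨point_isSimple, fun l hl => (l.head hl.1.1).elim⟩

lemma empty_isDAG : empty.{w}.IsDAG :=
  ⟨fun e => e.elim, fun l hl => (l.head hl.1.1).elim⟩

/-- Nodes are morphisms from `point`, which lies in `P`, so monomorphisms of the subcategory are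
tested there. -/
lemma mono_iff_injective_onV (hP : IsAdmissible P) (hpt : P point) {X Y : P.FullSubcategory}
    (f : X ⟶ Y) : Mono f ↔ Function.Injective f.hom.onV := by
  constructor
  · intro _ x y hxy
    have : (ObjectProperty.homMk (pointHom x) : ⟨point, hpt⟩ ⟶ X) =
        ObjectProperty.homMk (pointHom y) := by
      rw [← cancel_mono f]
      exact ObjectProperty.hom_ext _ (hom_ext (fun e => e.elim) fun _ => hxy)
    exact congrArg (fun k : (⟨point, hpt⟩ : P.FullSubcategory) ⟶ X => k.hom.onV PUnit.unit) this
  · intro h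
    have := mono_of_injective (hP.isSimple X.property) h
    exact P.ι.mono_of_mono_map this

lemma isDownwardClosed_iff {G H : DirGraph.{w}} (hG : G.IsSimple) (f : G ⟶ H) :
    IsDownwardClosed f ↔ IsClosedEmb True f := by
  constructor
  · rintro ⟨_, h⟩
    exact ⟨injective_of_mono f, fun e _ => h e⟩
  · rintro ⟨h, h'⟩
    exact ⟨mono_of_injective hG h, fun e => h' e (Or.inl trivial)⟩

/-- The graph with two nodes and one edge from the first to the second. -/
def arrow : DirGraph.{w} where
  E := PUnit
  V := ULift Bool
  s _ := ⟨false⟩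
  t _ := ⟨true⟩

/-- The morphism from the graph with one edge selecting an edge. -/
def arrowHom {G : DirGraph.{w}} (e : G.E) : arrow ⟶ G where
  onE _ := e
  onV x := bif x.down then G.t e else G.s e
  map_s _ := rfl
  map_t _ := rfl

/-- The simple graph with an edge between any two nodes. -/
def indiscrete (V : Type w) : DirGraph.{w} where
  E := V × V
  V := V
  s := Prod.fst
  t := Prod.snd

/-- A function defines a morphism to an indiscrete graph. -/
def indiscreteHom {G : DirGraph.{w}} {V : Type w} (k : G.V → V) : G ⟶ indiscrete V where
  onE e := (k (G.s e), k (G.t e))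
  onV := k
  map_s _ := rfl
  map_t _ := rfl

lemma isRegularMono_iff {X Y : SGraph.{w}} (f : X ⟶ Y) :
    IsRegularMono f ↔ IsClosedEmb False f.hom := by
  constructor
  · rintro ⟨⟨h⟩⟩
    have hf : Mono f := h.mono
    refine ⟨(mono_iff_injective_onV isAdmissible_isSimple point_isSimple f).1 hf, ?_⟩
    rintro e (⟨⟨⟩⟩ | ⟨x, hx⟩) ⟨y, hy⟩
    -- The edge `e`, seen as a map from `arrow`, is equalized because both maps agree on its
    -- endpoints and `h.Z` is simple; its factorization through `f` is the wanted edge.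
    let S : SGraph.{w} := ⟨arrow, fun _ _ _ _ => rfl⟩
    let k : S ⟶ Y := ObjectProperty.homMk (arrowHom e)
    have w : ∀ z, h.left.hom.onV (f.hom.onV z) = h.right.hom.onV (f.hom.onV z) := fun z =>
      congrArg (fun g : X ⟶ h.Z => g.hom.onV z) h.w
    have hk : k ≫ h.left = k ≫ h.right := by
      refine ObjectProperty.hom_ext _ (hom_ext_of_isSimple h.Z.property ?_)
      rintro ⟨_ | _⟩
      · exact (congrArg _ hx.symm).trans ((w x).trans (congrArg _ hx))
      · exact (congrArg _ hy.symm).trans ((w y).trans (congrArg _ hy))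
    obtain ⟨g, hg⟩ := Fork.IsLimit.lift' h.isLimit k hk
    exact ⟨g.hom.onE PUnit.unit, congrArg (fun m : S ⟶ Y => m.hom.onE PUnit.unit) hg⟩
  · rintro ⟨hf, hE⟩
    have : Mono f := (mono_iff_injective_onV isAdmissible_isSimple point_isSimple f).2 hf
    -- Any function on nodes extends to a map into an indiscrete graph, so `p` classifies the image
    -- of `f`; `f` is the equalizer of `p` and the constant `True`.
    let Z : SGraph.{w} := ⟨indiscrete (ULift.{w} Prop), fun _ _ hs ht => Prod.ext hs ht⟩
    let p : Y ⟶ Z := ObjectProperty.homMk (indiscreteHom fun x => ⟨x ∈ Set.range f.hom.onV⟩)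
    let q : Y ⟶ Z := ObjectProperty.homMk (indiscreteHom fun _ => ⟨True⟩)
    have w : f ≫ p = f ≫ q := ObjectProperty.hom_ext _ (hom_ext_of_isSimple Z.property
      fun x => ULift.ext _ _ (eq_true ⟨x, rfl⟩))
    have lift : ∀ (S : SGraph.{w}) (k : S ⟶ Y), k ≫ p = k ≫ q → ∃ g : S ⟶ X, g ≫ f = k := by
      intro S k hk
      have hV : ∀ x, k.hom.onV x ∈ Set.range f.hom.onV := fun x =>
        of_eq_true (congrArg (fun m : S ⟶ Z => (m.hom.onV x).down) hk)
      have hE' : ∀ e, k.hom.onE e ∈ Set.range f.hom.onE := fun e => hE _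
        (Or.inr (by rw [k.hom.map_s]; exact hV _)) (by rw [k.hom.map_t]; exact hV _)
      choose gV hgV using hV
      choose gE hgE using hE'
      refine ⟨ObjectProperty.homMk ⟨gE, gV, fun e => hf ?_, fun e => hf ?_⟩,
        ObjectProperty.hom_ext _ (hom_ext hgE hgV)⟩
      · rw [← f.hom.map_s, hgE, hgV, k.hom.map_s]
      · rw [← f.hom.map_t, hgE, hgV, k.hom.map_t]
    choose g hg using lift
    exact ⟨⟨⟨Z, p, q, w, Fork.IsLimit.mk _ (fun s => g _ s.ι s.condition) (fun s => hg ..)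
      fun s m hm => (cancel_mono f).1 (hm.trans (hg ..).symm)⟩⟩⟩

end DirGraph

/-! ### The two instances -/

open DirGraph

lemma SHGraph.classM_eq : SHGraph.classM.{w} = HGraph.closedEmb _ False := by
  ext X Y f
  exact and_congr (isRegularMono_iff f.left) (mono_iff_injective f.right)

lemma SHGraph.classN_eq : SHGraph.classN.{w} = HGraph.graphInjective _ := by
  ext X Y f
  exact mono_iff_injective_onV isAdmissible_isSimple point_isSimple f.left

lemma DAGHGraph.classM_eq : DAGHGraph.classM.{w} = HGraph.closedEmb _ True := by
  ext X Y f
  exact and_congr (isDownwardClosed_iff X.left.property.1 f.left.hom) (mono_iff_injective f.right)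

lemma DAGHGraph.classN_eq : DAGHGraph.classN.{w} = HGraph.graphInjective _ := by
  ext X Y f
  exact mono_iff_injective_onV isAdmissible_isDAG point_isDAG f.left

theorem mainTheorem10 :
    IsMNAdhesive SHGraph.classM.{w} SHGraph.classN.{w} ∧
    IsMNAdhesive DAGHGraph.classM.{w} DAGHGraph.classN.{w} ∧
    SHGraph.nodeSet.{w}.IsRightAdjoint ∧
    DAGHGraph.nodeSet.{w}.IsRightAdjoint := by
  rw [SHGraph.classM_eq, SHGraph.classN_eq, DAGHGraph.classM_eq, DAGHGraph.classN_eq]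
  refine ⟨HGraph.isMNAdhesive isAdmissible_isSimple _ fun f g _ _ _ _ => pushoutGraph_isSimple f g,
    HGraph.isMNAdhesive isAdmissible_isDAG _ fun f g hH hK hf _ => ?_,
    HGraph.isRightAdjoint_nodeSet empty_isDAG.1, HGraph.isRightAdjoint_nodeSet empty_isDAG⟩
  exact (isNodePushout_pushoutGraph f g).isDAG (pushoutGraph_condition f g) hf hH hK
    (pushoutGraph_isSimple f g)
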